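/- Let $R$ be a commutative ring with unity; all modules are unital $R$-modules. Definitions. A finitely generated ideal $J$ of $R$ is a $GV$-ideal if the natural map $R\to \mathrm{Hom}_R(J,R)$, $r\mapsto (x\mapsto rx)$, is an isomorphism. A module $M$ is a $w$-module if the only $x\in M$ with $Jx=0$ for some $GV$-ideal $J$ is $x=0$, and $\mathrm{Ext}^1_R(R/J,M)=0$ for every $GV$-ideal $J$. A $w$-ideal is an ideal that is a $w$-module, and a maximal $w$-ideal is a maximal element of the set of proper $w$-ideals (such ideals are prime). The ring $R$ is a $DW$-ring if every ideal of $R$ is a $w$-ideal, and it is coherent if every finitely generated ideal is finitely presented. A sequence $0\to A\to B\to C\to 0$ is $w$-exact if it is exact after localization at every maximal $w$-ideal. A module $A$ is absolutely pure if, whenever $A$ is a submodule of a module $B$, the map $A\otimes_R M\to B\otimes_R M$ is injective for every module $M$; it is absolutely $w$-pure if, whenever $A$ is a submodule of a module $B$, the sequence $0\to A\to B\to B/A\to 0$ is $w$-exact and so is $0\to A\otimes_R M\to B\otimes_R M\to (B/A)\otimes_R M\to 0$ for every module $M$. A module $M$ is $FP$-projective (resp. $w$-$FP$-projective) if $\mathrm{Ext}^1_R(M,A)=0$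 for every absolutely pure (resp. absolutely $w$-pure) module $A$. The ring $R$ is $FP$-hereditary if every ideal of $R$ is $FP$-projective. The $w$-$FP$-projective dimension $w\text{-}\mathrm{fpd}_R(M)$ of a module $M$ is the smallest integer $n\ge 0$ such that $\mathrm{Ext}^{n+1}_R(M,A)=0$ for every absolutely $w$-pure module $A$, and $\infty$ if there is no such $n$. Finally, $w\text{-}\mathrm{fpD}(R)$ is the supremum of $w\text{-}\mathrm{fpd}_R(M)$ over all finitely generated $R$-modules $M$. Proposition. The following are equivalent: 1. $w\text{-}\mathrm{fpD}(R)\le 1$; 2. every submodule of a $w$-$FP$-projective $R$-module is $w$-$FP$-projective; 3. every submodule of a projective $R$-module is $w$-$FP$-projective; 4. every ideal $I$ of $R$ is $w$-$FP$-projective; 5. $\mathrm{id}_R(A)\le 1$ for every absolutely $w$-pure $R$-module $A$; 6. $R$ is an $FP$-hereditary $DW$-ring; 7. $R$ is a coherent $FP$-hereditary $DW$-ring. -/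

import Mathlib

open CategoryTheory CategoryTheory.Abelian

universe u

namespace WFP

variable (R : Type u) [CommRing R]

/-- Vanishing of `Ext_R^n(M, N)`. -/
def ExtVanishes (M N : Type u) [AddCommGroup M] [Module R M] [AddCommGroup N] [Module R N]
    (n : ℕ) : Prop :=
  Subsingleton (Ext.{u} (ModuleCat.of R M) (ModuleCat.of R N) n)

variable {R}

/-- `J` is a Glaz-Vasconcelos ideal: `J` is finitely generated and the natural map
`R → Hom_R(J, R)`, `r ↦ (x ↦ r x)`, is an isomorphism. -/
def IsGVIdeal (J : Ideal R) : Prop :=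
  J.FG ∧ Function.Bijective (LinearMap.toSpanSingleton R (J →ₗ[R] R) J.subtype)

variable (R)

/-- The set `tor_GV(M) = {x ∈ M | J x = 0 for some GV-ideal J}`. -/
def torGV (M : Type u) [AddCommGroup M] [Module R M] : Set M :=
  {x | ∃ J : Ideal R, IsGVIdeal J ∧ ∀ j ∈ J, j • x = 0}

/-- `M` is GV-torsion-free: `tor_GV(M) = 0`. -/
def IsGVTorsionFree (M : Type u) [AddCommGroup M] [Module R M] : Prop :=
  torGV R M = {0}

/-- `M` is a `w`-module: it is GV-torsion-free and `Ext_R^1(R/J, M) = 0` for every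
GV-ideal `J`. -/
def IsWModule (M : Type u) [AddCommGroup M] [Module R M] : Prop :=
  IsGVTorsionFree R M ∧ ∀ J : Ideal R, IsGVIdeal J → ExtVanishes R (R ⧸ J) M 1

variable {R}

/-- An ideal is a `w`-ideal if it is a `w`-module. -/
def IsWIdeal (I : Ideal R) : Prop := IsWModule R I

/-- `p` is a maximal `w`-ideal: a maximal element of the set of proper `w`-ideals. -/
def IsMaximalWIdeal (p : Ideal R) : Prop :=
  Maximal (fun I : Ideal R => I ≠ ⊤ ∧ IsWIdeal I) p

variable (R)

/-- `R` is a DW-ring: every ideal is a `w`-ideal. -/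
def IsDWRing : Prop := ∀ I : Ideal R, IsWIdeal I

/-- `R` is coherent: every finitely generated ideal is finitely presented. -/
def IsCoherentRing : Prop := ∀ I : Ideal R, I.FG → Module.FinitePresentation R I

section Sequences

variable {R}
variable {A B C : Type u} [AddCommGroup A] [Module R A] [AddCommGroup B] [Module R B]
  [AddCommGroup C] [Module R C]

/-- The sequence `0 → A → B → C → 0` is `w`-exact: it becomes exact after localization at every
maximal `w`-ideal `p`. Every maximal `w`-ideal is prime; the primality
binder is there only so that the localization at `p` can be formed. -/
def IsWExact (f : A →ₗ[R] B) (g : B →ₗ[R] C) : Prop :=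
  ∀ (p : Ideal R) [p.IsPrime], IsMaximalWIdeal p →
    Function.Injective (LocalizedModule.map p.primeCompl f) ∧
    Function.Exact (LocalizedModule.map p.primeCompl f) (LocalizedModule.map p.primeCompl g) ∧
    Function.Surjective (LocalizedModule.map p.primeCompl g)

/-- The sequence `0 → A → B → C → 0` is `w`-pure exact: it is `w`-exact, and it stays `w`-exact
after tensoring with any module. -/
def IsWPureExact (f : A →ₗ[R] B) (g : B →ₗ[R] C) : Prop :=
  IsWExact f g ∧
    ∀ (M : Type u) [AddCommGroup M] [Module R M], IsWExact (f.rTensor M) (g.rTensor M)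

/-- The submodule `N` of `B` is pure: `N ⊗ M → B ⊗ M` is injective for every module `M`. -/
def IsPureSubmodule (N : Submodule R B) : Prop :=
  ∀ (M : Type u) [AddCommGroup M] [Module R M], Function.Injective (N.subtype.rTensor M)

/-- The submodule `N` of `B` is `w`-pure: `0 → N → B → B/N → 0` is `w`-pure exact. -/
def IsWPureSubmodule (N : Submodule R B) : Prop :=
  IsWPureExact N.subtype N.mkQ

end Sequences

/-- `A` is absolutely pure: it is pure in every module containing it. (A module containing `A` is
given by an injective linear map out of `A`.) -/
def IsAbsolutelyPure (A : Type u) [AddCommGroup A] [Module R A] : Prop :=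
  ∀ (B : Type u) [AddCommGroup B] [Module R B] (f : A →ₗ[R] B), Function.Injective f →
    IsPureSubmodule (LinearMap.range f)

/-- `A` is absolutely `w`-pure: it is `w`-pure in every module containing it. -/
def IsAbsolutelyWPure (A : Type u) [AddCommGroup A] [Module R A] : Prop :=
  ∀ (B : Type u) [AddCommGroup B] [Module R B] (f : A →ₗ[R] B), Function.Injective f →
    IsWPureSubmodule (LinearMap.range f)

/-- `M` is FP-projective: `Ext_R^1(M, A) = 0` for every absolutely pure `A`. -/
def IsFPProjective (M : Type u) [AddCommGroup M] [Module R M] : Prop :=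
  ∀ (A : Type u) [AddCommGroup A] [Module R A], IsAbsolutelyPure R A → ExtVanishes R M A 1

/-- `M` is `w`-FP-projective: `Ext_R^1(M, A) = 0` for every absolutely `w`-pure `A`. -/
def IsWFPProjective (M : Type u) [AddCommGroup M] [Module R M] : Prop :=
  ∀ (A : Type u) [AddCommGroup A] [Module R A], IsAbsolutelyWPure R A → ExtVanishes R M A 1

/-- `R` is FP-hereditary: every ideal is FP-projective. -/
def IsFPHereditary : Prop := ∀ I : Ideal R, IsFPProjective R I

/-- The `w`-FP-projective dimension of `M`: the smallest `n ≥ 0` such that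
`Ext_R^{n+1}(M, A) = 0` for every absolutely `w`-pure `A`, and `∞` if there is none. -/
noncomputable def wfpd (M : Type u) [AddCommGroup M] [Module R M] : ℕ∞ :=
  sInf {d : ℕ∞ | ∃ n : ℕ, d = n ∧
    ∀ (A : Type u) [AddCommGroup A] [Module R A],
      IsAbsolutelyWPure R A → ExtVanishes R M A (n + 1)}

/-- The `w`-FP-projective dimension of `R`: the supremum of the `w`-FP-projective dimensions of
the finitely generated modules. -/
noncomputable def wfpD : ℕ∞ :=
  ⨆ (M : ModuleCat.{u} R) (_ : Module.Finite R M), wfpd R M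

end WFP

/-! Dimension shifting along `0 → I → R → R/I → 0` turns condition 4 into `Ext²(R/I, A) = 0` for all
absolutely `w`-pure `A`. By Baer's criterion applied to a cosyzygy of `A`, this is `id A ≤ 1`, which
gives conditions 1, 2 and 3.

The ring-theoretic content is in two constructions of test modules. A finite FP-projective module is
finitely presented (`fg_of_forall_exists_extension`), hence coherence. A module killed by a GV-ideal
`J` vanishes at every maximal `w`-ideal, so it is absolutely `w`-pure; testing `J` against `K/JK`,
with `K` the kernel of a finite presentation of `J`, forces `J = R` (`IsGVIdeal.eq_top`), hence DW.
Conversely, over a DW-ring absolutely `w`-pure modules are absolutely pure, so FP-projective modules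
are `w`-FP-projective. -/

namespace WFP

variable {R : Type u} [CommRing R]

/-! ### Vanishing of Ext, extension of maps, injective dimension at most one. -/

section Ext

variable {A B M N : Type u} [AddCommGroup A] [Module R A] [AddCommGroup B] [Module R B]
  [AddCommGroup M] [Module R M] [AddCommGroup N] [Module R N]

/-- The short complex `0 → K → B → B ⧸ K → 0`. -/
abbrev quotientShortComplex (K : Submodule R B) : ShortComplex (ModuleCat.{u} R) :=
  ShortComplex.mk (ModuleCat.ofHom K.subtype) (ModuleCat.ofHom K.mkQ)
    (by ext x; simp)

lemma quotientShortComplex_shortExact (K : Submodule R B) :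
    (quotientShortComplex K).ShortExact :=
  ModuleCat.shortComplex_shortExact _ (LinearMap.exact_subtype_mkQ K) K.injective_subtype
    K.mkQ_surjective

lemma ExtVanishes.of_retract {n : ℕ} (i : M →ₗ[R] N) (r : N →ₗ[R] M)
    (h : r ∘ₗ i = LinearMap.id) (hN : ExtVanishes R N A n) : ExtVanishes R M A n := by
  unfold ExtVanishes at *
  refine subsingleton_of_forall_eq 0 fun x ↦ ?_
  have h₁ : (Ext.mk₀ (ModuleCat.ofHom r)).comp x (zero_add n) = 0 := Subsingleton.elim _ _
  have h₂ : ModuleCat.ofHom i ≫ ModuleCat.ofHom r = 𝟙 (ModuleCat.of R M) := by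
    rw [← ModuleCat.ofHom_comp, h]; rfl
  calc x = (Ext.mk₀ (ModuleCat.ofHom i)).comp
        ((Ext.mk₀ (ModuleCat.ofHom r)).comp x (zero_add n)) (zero_add n) := by
        rw [Ext.mk₀_comp_mk₀_assoc, h₂, Ext.mk₀_id_comp]
    _ = 0 := by rw [h₁, Ext.comp_zero]

lemma ExtVanishes.of_linearEquiv {n : ℕ} (e : M ≃ₗ[R] N) (hN : ExtVanishes R N A n) :
    ExtVanishes R M A n :=
  hN.of_retract e.toLinearMap e.symm.toLinearMap (by ext; simp)

lemma extVanishes_of_projective [Module.Projective R M] (n : ℕ) :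
    ExtVanishes R M A (n + 1) := by
  have : Projective (ModuleCat.of R M) := (IsProjective.iff_projective M).mp ‹_›
  exact Ext.subsingleton_of_projective _ _ _

lemma ExtVanishes.submodule {n : ℕ} (K : Submodule R B) (hB : ExtVanishes R B A n)
    (hQ : ExtVanishes R (B ⧸ K) A (n + 1)) : ExtVanishes R K A n := by
  unfold ExtVanishes at *
  refine subsingleton_of_forall_eq 0 fun x ↦ ?_
  obtain ⟨y, rfl⟩ := Ext.contravariant_sequence_exact₁ (quotientShortComplex_shortExact K) _ x
    (add_comm 1 n) (Subsingleton.elim (α := Ext (ModuleCat.of R (B ⧸ K)) _ _) _ _)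
  rw [Subsingleton.elim (α := Ext (ModuleCat.of R B) _ _) y 0, Ext.comp_zero]

lemma ExtVanishes.quotient {n : ℕ} (K : Submodule R B) (hB : ExtVanishes R B A (n + 1))
    (hK : ExtVanishes R K A n) : ExtVanishes R (B ⧸ K) A (n + 1) := by
  unfold ExtVanishes at *
  refine subsingleton_of_forall_eq 0 fun x ↦ ?_
  obtain ⟨y, rfl⟩ := Ext.contravariant_sequence_exact₃ (quotientShortComplex_shortExact K) _ x
    (Subsingleton.elim (α := Ext (ModuleCat.of R B) _ _) _ _) (add_comm 1 n)
  rw [Subsingleton.elim (α := Ext (ModuleCat.of R K) _ _) y 0, Ext.comp_zero]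

/-- The obstruction to extending `f` is its image under the connecting map to `Ext¹(B/K, A)`. -/
lemma ExtVanishes.exists_extension {K : Submodule R B} (h : ExtVanishes R (B ⧸ K) A 1)
    (f : K →ₗ[R] A) : ∃ g : B →ₗ[R] A, ∀ x : K, g x = f x := by
  unfold ExtVanishes at h
  obtain ⟨y, hy⟩ := Ext.contravariant_sequence_exact₁ (quotientShortComplex_shortExact K) _
    (Ext.mk₀ (ModuleCat.ofHom f)) (add_zero 1)
    (Subsingleton.elim (α := Ext (ModuleCat.of R (B ⧸ K)) _ _) _ _)
  obtain ⟨g, rfl⟩ := (Ext.mk₀_bijective _ _).surjective y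
  rw [Ext.mk₀_comp_mk₀] at hy
  have := (Ext.mk₀_bijective _ _).injective hy
  exact ⟨g.hom, fun x ↦ congr($this x)⟩

lemma injective_of_extVanishes
    (h : ∀ I : Ideal R, ExtVanishes R (R ⧸ I) A 1) : Injective (ModuleCat.of R A) := by
  rw [← Module.injective_iff_injective_object]
  refine Module.Baer.injective fun I f ↦ ?_
  obtain ⟨g, hg⟩ := (h I).exists_extension f
  exact ⟨g, fun x hx ↦ hg ⟨x, hx⟩⟩

/-- For `0 → A → E → C → 0` with `E` injective, `Ext¹(R/I, C)` embeds in `Ext²(R/I, A)`, so `C` is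
injective by Baer. -/
lemma injectiveDimension_le_one_of_extVanishes
    (h : ∀ I : Ideal R, ExtVanishes R (R ⧸ I) A 2) :
    injectiveDimension (ModuleCat.of R A) ≤ 1 := by
  obtain ⟨E, _, f, _⟩ := EnoughInjectives.presentation (ModuleCat.of R A)
  let S : ShortComplex (ModuleCat.{u} R) :=
    ModuleCat.shortComplexOfCompEqZero _ _ f.hom.exact_map_mkQ_range.linearMap_comp_eq_zero
  have hS : S.ShortExact := ModuleCat.shortComplex_shortExact S
    f.hom.exact_map_mkQ_range ((ModuleCat.mono_iff_injective f).mp ‹_›)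
    (Submodule.mkQ_surjective _)
  have hC : Injective S.X₃ := by
    refine injective_of_extVanishes (A := E ⧸ f.hom.range) fun I ↦ ?_
    refine subsingleton_of_forall_eq 0 fun x ↦ ?_
    have := h I
    unfold ExtVanishes at this
    obtain ⟨y, rfl⟩ := Ext.covariant_sequence_exact₃ (ModuleCat.of R (R ⧸ I)) hS x rfl
      (Subsingleton.elim (α := Ext _ (ModuleCat.of R A) 2) _ _)
    rw [Ext.eq_zero_of_injective (I := E) y, Ext.zero_comp]
  refine (injectiveDimension_le_iff (ModuleCat.of R A) 1).mpr ?_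
  exact (hS.hasInjectiveDimensionLT_X₃_iff 0 ‹_›).mp
    (injective_iff_hasInjectiveDimensionLT_one.mp hC)

lemma extVanishes_two_of_injectiveDimension_le_one
    (h : injectiveDimension (ModuleCat.of R A) ≤ 1) : ExtVanishes R M A 2 := by
  have := (injectiveDimension_le_iff (ModuleCat.of R A) 1).mp h
  exact HasInjectiveDimensionLT.subsingleton (ModuleCat.of R A) 2 2 le_rfl _

end Ext

/-! ### Absolute purity and absolute `w`-purity. -/

section Purity

variable {A B C : Type u} [AddCommGroup A] [Module R A] [AddCommGroup B] [Module R B]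
  [AddCommGroup C] [Module R C]

lemma IsWExact.of_exact {f : A →ₗ[R] B} {g : B →ₗ[R] C} (hf : Function.Injective f)
    (hfg : Function.Exact f g) (hg : Function.Surjective g) : IsWExact f g := fun _ _ _ ↦
  ⟨LocalizedModule.map_injective _ f hf, LocalizedModule.map_exact _ f g hfg,
    LocalizedModule.map_surjective _ g hg⟩

lemma isAbsolutelyWPure_of_isAbsolutelyPure (hA : IsAbsolutelyPure R A) :
    IsAbsolutelyWPure R A := fun B _ _ f hf ↦
  ⟨.of_exact (Submodule.injective_subtype _) (LinearMap.exact_subtype_mkQ _)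
    (Submodule.mkQ_surjective _), fun M _ _ ↦
    .of_exact (hA B f hf M) (rTensor_exact M (LinearMap.exact_subtype_mkQ _)
      (Submodule.mkQ_surjective _)) (LinearMap.rTensor_surjective M (Submodule.mkQ_surjective _))⟩

/-- Over a DW-ring every maximal ideal is a maximal `w`-ideal, and injectivity is tested at maximal
ideals. -/
lemma IsDWRing.isAbsolutelyPure (hR : IsDWRing R) (hA : IsAbsolutelyWPure R A) :
    IsAbsolutelyPure R A := fun B _ _ f hf M _ _ ↦
  injective_of_localized_maximal _ fun P hP ↦
    (((hA B f hf).2 M) P ⟨⟨hP.ne_top, hR P⟩, fun _ hI hPI ↦ (hP.eq_of_le hI.1 hPI).ge⟩).1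

/-- A module which is, in a directed manner, a union of retracts of an injective module is
absolutely pure. -/
lemma isAbsolutelyPure_of_eventually_retract {ι : Type*} {l : Filter ι} [l.NeBot]
    [Module.Injective R B] (i : A →ₗ[R] B) (e : ι → B →ₗ[R] A)
    (h : ∀ a, ∀ᶠ t in l, e t (i a) = a) : IsAbsolutelyPure R A := by
  have hi : ∀ (M : Type u) [AddCommGroup M] [Module R M],
      Function.Injective (i.rTensor M) := by
    intro M _ _
    refine (injective_iff_map_eq_zero _).mpr fun x hx ↦ ?_
    -- A tensor involves finitely many elements of `A`, so a single `e t` eventually splits `i` on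
    -- all of them.
    have key : ∀ᶠ t in l, (e t).rTensor M (i.rTensor M x) = x := by
      clear hx
      induction x with
      | zero => simp
      | tmul a m => filter_upwards [h a] with t ht; simp [ht]
      | add x y hx hy => filter_upwards [hx, hy] with t h₁ h₂; simp [h₁, h₂]
    obtain ⟨t, ht⟩ := key.exists
    rw [← ht, hx, map_zero]
  intro B' _ _ f hf M _ _
  have hinj : Function.Injective i := by
    refine (injective_iff_map_eq_zero _).mpr fun x hx ↦ ?_
    obtain ⟨t, ht⟩ := (h x).exists
    rw [← ht, hx, map_zero]
  let e' := LinearEquiv.ofInjective f hf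
  -- Purity passes from `i` to an arbitrary embedding `f`, because `i` factors through `f` by
  -- injectivity of `B`.
  obtain ⟨g, hg⟩ := Module.Injective.out f hf i
  have hcomp : (g ∘ₗ (LinearMap.range f).subtype) = i ∘ₗ e'.symm.toLinearMap := by
    ext ⟨_, a, rfl⟩
    have : e'.symm ⟨f a, a, rfl⟩ = a := e'.symm_apply_eq.mpr rfl
    simp [hg, this]
  have : Function.Injective ((g ∘ₗ (LinearMap.range f).subtype).rTensor M) := by
    rw [hcomp, LinearMap.rTensor_comp]
    exact (hi M).comp (e'.symm.rTensor M).injective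
  rw [LinearMap.rTensor_comp] at this
  exact Function.Injective.of_comp this

end Purity

/-! ### Finite generation tested on absolutely pure modules. -/

section FinitePresentation

variable {F : Type u} [AddCommGroup F] [Module R F]

/-- A submodule `K` of a finite module is finitely generated as soon as every map from `K` to an
absolutely pure module extends. -/
lemma fg_of_forall_exists_extension [Module.Finite R F] (K : Submodule R F)
    (h : ∀ (A : Type u) [AddCommGroup A] [Module R A], IsAbsolutelyPure R A →
      ∀ f : K →ₗ[R] A, ∃ g : F →ₗ[R] A, ∀ x : K, g x = f x) : K.FG := by
  classical
  let ι := {S : Submodule R F // S.FG ∧ S ≤ K}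
  have : Nonempty ι := ⟨⟨⊥, Submodule.fg_bot, bot_le⟩⟩
  have : IsDirectedOrder ι := ⟨fun S T ↦ ⟨⟨S.1 ⊔ T.1, S.2.1.sup T.2.1, sup_le S.2.2 T.2.2⟩,
    le_sup_left (a := S.1), le_sup_right (a := S.1)⟩⟩
  have hE : ∀ S : ι, ∃ (E : ModuleCat.{u} R) (j : (F ⧸ S.1) →ₗ[R] E), Module.Injective R E ∧
      Function.Injective j := fun S ↦ by
    obtain ⟨E, _, f, _⟩ := EnoughInjectives.presentation (ModuleCat.of R (F ⧸ S.1))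
    exact ⟨E, f.hom, Module.injective_module_of_injective_object R E,
      (ModuleCat.mono_iff_injective f).mp ‹_›⟩
  choose E j hE hj using hE
  -- The test module: families that vanish for all large finitely generated `S ≤ K`.
  let A : Submodule R (∀ S, E S) :=
    { carrier := {x | ∀ᶠ S in Filter.atTop, x S = 0}
      add_mem' := fun {x y} hx hy ↦ by
        filter_upwards [hx, hy] with S h₁ h₂
        simp [h₁, h₂]
      zero_mem' := .of_forall fun _ ↦ rfl
      smul_mem' := fun r x hx ↦ by
        filter_upwards [hx] with S h₁
        simp [h₁] }
  -- Truncation: coordinates at `S ≥ T` are set to zero, so an element of `A` is fixed once `T` is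
  -- large.
  let e (T : ι) : (∀ S, E S) →ₗ[R] A :=
    LinearMap.codRestrict A (LinearMap.pi fun S ↦ if T ≤ S then 0 else LinearMap.proj S)
      fun x ↦ by
        filter_upwards [Filter.eventually_ge_atTop T] with S hS
        simp [hS]
  have hA : IsAbsolutelyPure R A := by
    refine isAbsolutelyPure_of_eventually_retract (l := Filter.atTop) A.subtype e fun a ↦ ?_
    obtain ⟨T, hT⟩ := Filter.eventually_atTop.mp a.2
    filter_upwards [Filter.eventually_ge_atTop T] with T' hT'
    ext S
    change (if T' ≤ S then 0 else LinearMap.proj S : (∀ S, E S) →ₗ[R] E S) a.1 = a.1 S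
    by_cases hS : T' ≤ S
    · simp [hS, hT S (hT'.trans hS)]
    · simp [hS]
  -- The `S`-coordinate of `d` has kernel exactly `S`. An element of `K` lies in every large `S`, so
  -- `d` maps `K` into `A`.
  let d : F →ₗ[R] (∀ S, E S) := LinearMap.pi fun S ↦ j S ∘ₗ S.1.mkQ
  obtain ⟨g, hg⟩ := h A hA (LinearMap.codRestrict A (d ∘ₗ K.subtype) fun x ↦ by
    have hx : Submodule.span R {(x : F)} ≤ K := by simp
    filter_upwards [Filter.eventually_ge_atTop
      (⟨_, Submodule.fg_span_singleton _, hx⟩ : ι)] with S hS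
    have : (x : F) ∈ S.1 := hS (Submodule.mem_span_singleton_self _)
    simp [d, (Submodule.Quotient.mk_eq_zero S.1).mpr this])
  -- Since `F` has finitely many generators, the extension `g` vanishes entirely in some coordinate
  -- `S`; hence `K ≤ S`.
  obtain ⟨s, hs⟩ := Module.Finite.fg_top (R := R) (M := F)
  have hev : ∀ᶠ S in Filter.atTop, ∀ b ∈ s, (g b).1 S = 0 :=
    (Filter.eventually_all_finset s).mpr fun b _ ↦ (g b).2
  obtain ⟨S, hS⟩ := hev.exists
  have hzero : LinearMap.proj S ∘ₗ A.subtype ∘ₗ g = 0 :=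
    LinearMap.ext_on hs fun b hb ↦ hS b hb
  have hKS : K ≤ S.1 := fun x hx ↦ by
    have h₁ : (g x).1 S = 0 := congr($hzero x)
    rw [hg ⟨x, hx⟩] at h₁
    have h₂ : j S (S.1.mkQ x) = 0 := h₁
    exact (Submodule.Quotient.mk_eq_zero _).mp (hj S (h₂.trans (map_zero _).symm))
  exact le_antisymm hKS S.2.2 ▸ S.2.1

end FinitePresentation

/-! ### GV-ideals and the DW property. -/

section GV

lemma IsGVIdeal.eq_zero_of_forall_mul_eq_zero {J : Ideal R} (hJ : IsGVIdeal J) {r : R}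
    (h : ∀ x ∈ J, r * x = 0) : r = 0 :=
  hJ.2.1 (LinearMap.ext fun x ↦ by simpa using h x x.2)

lemma IsGVIdeal.exists_eq_mul {J : Ideal R} (hJ : IsGVIdeal J) (f : J →ₗ[R] R) :
    ∃ r : R, ∀ x : J, f x = r * x := by
  obtain ⟨r, rfl⟩ := hJ.2.2 f
  exact ⟨r, fun x ↦ by simp⟩

/-- If `J ≤ I`, the inclusion `J → I` extends to `R → I`, multiplication by some `a ∈ I`. Then `a -
1` kills `J`, so `a = 1`. -/
lemma IsGVIdeal.not_le_of_isWIdeal {J I : Ideal R} (hJ : IsGVIdeal J) (hI : IsWIdeal I)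
    (hI' : I ≠ ⊤) : ¬ J ≤ I := fun hle ↦ by
  obtain ⟨g, hg⟩ := (hI.2 J hJ).exists_extension (Submodule.inclusion hle)
  have h1 : ((g 1 : I) : R) - 1 = 0 := hJ.eq_zero_of_forall_mul_eq_zero fun x hx ↦ by
    have h2 : g x = Submodule.inclusion hle ⟨x, hx⟩ := hg ⟨x, hx⟩
    have h3 : g x = x • g 1 := by rw [← map_smul, smul_eq_mul, mul_one]
    have h4 : x * (g 1 : R) = x := by
      have := congr(($h3 : R))
      rw [h2] at this
      simpa using this.symm
    rw [sub_mul, one_mul, mul_comm, h4, sub_self]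
  exact hI' ((Ideal.eq_top_iff_one I).mpr (sub_eq_zero.mp h1 ▸ (g 1).2))

lemma IsGVIdeal.subsingleton_localizedModule {J : Ideal R} (hJ : IsGVIdeal J) {T : Type u}
    [AddCommGroup T] [Module R T] (hT : ∀ j ∈ J, ∀ x : T, j • x = 0) {p : Ideal R} [p.IsPrime]
    (hp : IsMaximalWIdeal p) : Subsingleton (LocalizedModule p.primeCompl T) := by
  obtain ⟨j, hj, hjp⟩ := Set.not_subset.mp (hJ.not_le_of_isWIdeal hp.1.2 hp.1.1)
  exact LocalizedModule.subsingleton_iff.mpr fun m ↦ ⟨j, hjp, hT j hj m⟩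

/-- A module killed by a GV-ideal is absolutely `w`-pure. -/
lemma IsGVIdeal.isAbsolutelyWPure {J : Ideal R} (hJ : IsGVIdeal J) {T : Type u}
    [AddCommGroup T] [Module R T] (hT : ∀ j ∈ J, ∀ x : T, j • x = 0) :
    IsAbsolutelyWPure R T := by
  have key {N B C : Type u} [AddCommGroup N] [Module R N] [AddCommGroup B] [Module R B]
      [AddCommGroup C] [Module R C] (f : N →ₗ[R] B) (g : B →ₗ[R] C)
      (hN : ∀ j ∈ J, ∀ x : N, j • x = 0) (hfg : Function.Exact f g)
      (hg : Function.Surjective g) : IsWExact f g := fun p _ hp ↦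
    have := hJ.subsingleton_localizedModule hN hp
    ⟨Function.injective_of_subsingleton _, LocalizedModule.map_exact _ f g hfg,
      LocalizedModule.map_surjective _ g hg⟩
  intro B _ _ f _
  have hN : ∀ j ∈ J, ∀ x : LinearMap.range f, j • x = 0 := by
    rintro j hj ⟨_, x, rfl⟩
    ext
    simp [← map_smul, hT j hj]
  refine ⟨key _ _ hN (LinearMap.exact_subtype_mkQ _) (Submodule.mkQ_surjective _),
    fun M _ _ ↦ key _ _ (fun j hj x ↦ ?_) (rTensor_exact M (LinearMap.exact_subtype_mkQ _)
      (Submodule.mkQ_surjective _)) (LinearMap.rTensor_surjective M (Submodule.mkQ_surjective _))⟩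
  induction x with
  | zero => simp
  | tmul a m => rw [TensorProduct.smul_tmul', hN j hj, TensorProduct.zero_tmul]
  | add x y hx hy => rw [smul_add, hx, hy, add_zero]

open Polynomial in
/-- If an endomorphism of a finite module `K` is the identity modulo `J`, then some `c ∈ 1 + J`
factors through it as a scalar. -/
lemma exists_comp_eq_smul_of_sub_mem_smul_top {K : Type*} [AddCommGroup K] [Module R K]
    [Module.Finite R K] (J : Ideal R) (φ : Module.End R K)
    (hφ : ∀ x, φ x - x ∈ J • (⊤ : Submodule R K)) :
    ∃ (c : R) (q : Module.End R K), c - 1 ∈ J ∧ ∀ x, q (φ x) = c • x := by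
  -- Cayley–Hamilton for `1 - φ`: the lower coefficients of the monic `p` lie in `J`, so `c = p(1)`
  -- is in `1 + J`, and dividing `p - p(1)` by `X - 1` yields `q`.
  obtain ⟨p, hp, -, hcoeff, h0⟩ :=
    LinearMap.exists_monic_and_natDegree_eq_and_coeff_mem_pow_and_aeval_eq_zero R
      (LinearMap.id - φ) J (by
        rintro _ ⟨x, rfl⟩
        simpa using neg_mem (hφ x))
  obtain ⟨q, hq⟩ := Polynomial.X_sub_C_dvd_sub_C_eval (a := (1 : R)) (p := p)
  refine ⟨p.eval 1, aeval (LinearMap.id - φ) q, ?_, fun x ↦ ?_⟩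
  · rw [Polynomial.eval_eq_sum_range, Finset.sum_range_succ, hp.coeff_natDegree]
    simp only [one_pow, mul_one, add_sub_cancel_right]
    refine Ideal.sum_mem _ fun k hk ↦ Ideal.pow_le_self ?_ (hcoeff k)
    have := Finset.mem_range.mp hk
    omega
  · rw [mul_comm] at hq
    have := congr((aeval (LinearMap.id - φ) $hq : Module.End R K) x)
    have h1 : (LinearMap.id - φ - 1 : Module.End R K) = -φ := by
      ext; simp
    simp [h0, h1] at this
    exact this.symm

/-- A finitely presented GV-ideal `J` with `Ext¹(J, T) = 0` for all `T` killed by `J` is the unit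
ideal. -/
lemma IsGVIdeal.eq_top {J : Ideal R} (hJ : IsGVIdeal J) [Module.FinitePresentation R J]
    (h : ∀ (T : Type u) [AddCommGroup T] [Module R T], (∀ j ∈ J, ∀ x : T, j • x = 0) →
      ExtVanishes R J T 1) : J = ⊤ := by
  obtain ⟨n, π, hπ⟩ := Module.Finite.exists_fin' R J
  let K := LinearMap.ker π
  have : Module.Finite R K := .of_fg (Module.FinitePresentation.fg_ker π hπ)
  let e : ((Fin n → R) ⧸ K) ≃ₗ[R] J := π.quotKerEquivOfSurjective hπ
  have he : ∀ y, e.symm (π y) = K.mkQ y := fun y ↦ e.symm_apply_eq.mpr rfl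
  have hT : ∀ j ∈ J, ∀ x : K ⧸ (J • (⊤ : Submodule R K)), j • x = 0 := by
    intro j hj x
    obtain ⟨x, rfl⟩ := Submodule.mkQ_surjective _ x
    rw [← map_smul]
    exact (Submodule.Quotient.mk_eq_zero _).mpr (Submodule.smul_mem_smul hj trivial)
  -- `K → K/JK` extends to `Rⁿ` and then lifts to `ψ : Rⁿ → K`, which is the identity on `K` modulo
  -- `J`.
  obtain ⟨φ, hφ⟩ := ((h _ hT).of_linearEquiv e).exists_extension
    (J • (⊤ : Submodule R K)).mkQ
  obtain ⟨ψ, hψ⟩ := Module.projective_lifting_property (J • (⊤ : Submodule R K)).mkQ φ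
    (Submodule.mkQ_surjective _)
  obtain ⟨c, q, hc, hq⟩ := exists_comp_eq_smul_of_sub_mem_smul_top J (ψ ∘ₗ K.subtype)
    fun x ↦ by
      rw [← Submodule.Quotient.mk_eq_zero, Submodule.Quotient.mk_sub, sub_eq_zero]
      exact congr($hψ x).trans (hφ x)
  -- `χ = c - qψ` kills `K`, so it descends to `g : J → Rⁿ` with `π ∘ g = c`: the presentation
  -- splits up to `c`.
  let χ : (Fin n → R) →ₗ[R] (Fin n → R) := c • LinearMap.id - K.subtype ∘ₗ q ∘ₗ ψ
  have hχ : K ≤ LinearMap.ker χ := fun x hx ↦ by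
    have := congr(($(hq ⟨x, hx⟩) : Fin n → R))
    simp only [LinearMap.comp_apply, Submodule.subtype_apply, Submodule.coe_smul] at this
    simp [χ, this]
  let g : J →ₗ[R] (Fin n → R) := K.liftQ χ hχ ∘ₗ e.symm.toLinearMap
  have hg : ∀ x, π (g x) = c • x := fun x ↦ by
    obtain ⟨y, rfl⟩ := hπ x
    have h1 : g (π y) = χ y := by simp [g, he]
    have h2 : π (q (ψ y)).1 = 0 := (q (ψ y)).2
    rw [h1]
    simp [χ, h2]
  -- As `J` is GV, each coordinate of `g` is multiplication by some `r i`. So `c` and `∑ r i *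
  -- π(e_i) ∈ J` agree as multipliers on `J`, hence are equal; with `c ∈ 1 + J` this gives `1 ∈ J`.
  choose r hr using fun i ↦ hJ.exists_eq_mul (LinearMap.proj i ∘ₗ g)
  have hcJ : c - ∑ i, r i * π (Pi.single i 1) = 0 :=
    hJ.eq_zero_of_forall_mul_eq_zero fun x hx ↦ by
      have h1 := congr(($(hg ⟨x, hx⟩) : R))
      rw [LinearMap.pi_apply_eq_sum_univ π] at h1
      have h2 : ∀ i, g ⟨x, hx⟩ i = r i * x := fun i ↦ hr i ⟨x, hx⟩
      simp only [h2, Submodule.coe_sum, Submodule.coe_smul, smul_eq_mul] at h1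
      rw [sub_mul, ← h1, Finset.sum_mul, sub_eq_zero]
      refine Finset.sum_congr rfl fun i _ ↦ ?_
      have : (fun j : Fin n ↦ if i = j then (1 : R) else 0) = Pi.single i 1 := by
        ext j; simp [Pi.single_apply, eq_comm]
      rw [this]
      ring
  have hc' : c ∈ J := by
    rw [sub_eq_zero.mp hcJ]
    exact Ideal.sum_mem _ fun i _ ↦ J.mul_mem_left _ (π _).2
  exact (Ideal.eq_top_iff_one J).mpr (by simpa using sub_mem hc' hc)

lemma isDWRing_of_forall_isGVIdeal_eq_top (h : ∀ J : Ideal R, IsGVIdeal J → J = ⊤) :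
    IsDWRing R := fun I ↦ by
  refine ⟨Set.eq_singleton_iff_unique_mem.mpr ⟨⟨⊤, ⟨Module.Finite.fg_top, ?_⟩, by simp⟩, ?_⟩,
    fun J hJ ↦ ?_⟩
  -- `⊤` is a GV-ideal, which puts `0` in `torGV`.
  · refine ⟨fun r s hrs ↦ by simpa using congr($hrs ⟨1, trivial⟩),
      fun f ↦ ⟨f ⟨1, trivial⟩, LinearMap.ext fun x ↦ ?_⟩⟩
    have : x = (x : R) • (⟨1, trivial⟩ : (⊤ : Ideal R)) := by ext; simp
    conv_rhs => rw [this, map_smul]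
    simp [mul_comm]
  · rintro x ⟨J, hJ, hx⟩
    simpa using hx 1 (h J hJ ▸ trivial)
  · obtain rfl := h J hJ
    have : Subsingleton (R ⧸ (⊤ : Ideal R)) := Ideal.Quotient.subsingleton_iff.mpr rfl
    exact extVanishes_of_projective 0

end GV

/-! ### Dimension bounds, and the coherent and DW conclusions. -/

lemma isWFPProjective_iff_extVanishes_two (I : Ideal R) :
    IsWFPProjective R I ↔ ∀ (A : Type u) [AddCommGroup A] [Module R A],
      IsAbsolutelyWPure R A → ExtVanishes R (R ⧸ I) A 2 :=
  ⟨fun h A _ _ hA ↦ (extVanishes_of_projective 1).quotient I (h A hA),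
    fun h A _ _ hA ↦ (extVanishes_of_projective 0).submodule I (h A hA)⟩

/-- Two cases remain because `wfpd` asks for vanishing in a single degree: `Ext¹ = 0` is not assumed
to propagate to `Ext²`. -/
lemma wfpd_le_one_iff {M : Type u} [AddCommGroup M] [Module R M] :
    wfpd R M ≤ 1 ↔ IsWFPProjective R M ∨ ∀ (A : Type u) [AddCommGroup A] [Module R A],
      IsAbsolutelyWPure R A → ExtVanishes R M A 2 := by
  constructor
  · intro h
    have hne : {d : ℕ∞ | ∃ n : ℕ, d = n ∧ ∀ (A : Type u) [AddCommGroup A] [Module R A],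
        IsAbsolutelyWPure R A → ExtVanishes R M A (n + 1)}.Nonempty := by
      by_contra hne
      rw [Set.not_nonempty_iff_eq_empty] at hne
      rw [wfpd, hne, sInf_empty] at h
      exact absurd h (by simp)
    obtain ⟨n, hn, hM⟩ := csInf_mem hne
    rw [wfpd, hn] at h
    have : n ≤ 1 := by exact_mod_cast h
    interval_cases n
    · exact .inl hM
    · exact .inr hM
  · rintro (h | h)
    · exact le_trans (sInf_le ⟨0, rfl, h⟩) zero_le_one
    · exact sInf_le ⟨1, rfl, h⟩

/-- The supremum over all finite modules removes the `Ext¹` alternative. If `Ext²(M₀, A₀) ≠ 0`, then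
`M₀ × N` must satisfy that alternative for every finite `N`, hence so does `N`. Taking `N = R/I`
makes `A₀` injective, a contradiction. -/
lemma wfpD_le_one_iff :
    wfpD R ≤ 1 ↔ ∀ (M : Type u) [AddCommGroup M] [Module R M], Module.Finite R M →
      ∀ (A : Type u) [AddCommGroup A] [Module R A],
      IsAbsolutelyWPure R A → ExtVanishes R M A 2 := by
  constructor
  · intro h M₀ _ _ _ A₀ _ _ hA₀
    by_contra hne
    have hle (M : Type u) [AddCommGroup M] [Module R M] [hM : Module.Finite R M] :
        wfpd R M ≤ 1 := by
      rw [wfpD, iSup₂_le_iff] at h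
      exact h (ModuleCat.of R M) hM
    have hproj (N : Type u) [AddCommGroup N] [Module R N] [Module.Finite R N] :
        IsWFPProjective R N := fun A _ _ hA ↦ by
      rcases wfpd_le_one_iff.mp (hle (M₀ × N)) with h | h
      · exact (h A hA).of_retract (LinearMap.inr R M₀ N) (LinearMap.snd R M₀ N) (by ext; simp)
      · exact (hne ((h A₀ hA₀).of_retract (LinearMap.inl R M₀ N) (LinearMap.fst R M₀ N)
          (by ext; simp))).elim
    have := injective_of_extVanishes fun I : Ideal R ↦ hproj (R ⧸ I) A₀ hA₀
    exact hne (Ext.subsingleton_of_injective _ _ _)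
  · exact fun h ↦ iSup₂_le fun M hM ↦ wfpd_le_one_iff.mpr (.inr (h M hM))

lemma IsDWRing.isWFPProjective (hR : IsDWRing R) {M : Type u}
    [AddCommGroup M] [Module R M] (hM : IsFPProjective R M) : IsWFPProjective R M :=
  fun A _ _ hA ↦ hM A (hR.isAbsolutelyPure hA)

lemma IsWFPProjective.isFPProjective {M : Type u}
    [AddCommGroup M] [Module R M] (hM : IsWFPProjective R M) : IsFPProjective R M :=
  fun A _ _ hA ↦ hM A (isAbsolutelyWPure_of_isAbsolutelyPure hA)

/-- A finite FP-projective module is finitely presented. -/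
lemma IsFPProjective.finitePresentation {M : Type u} [AddCommGroup M] [Module R M]
    [Module.Finite R M] (hM : IsFPProjective R M) : Module.FinitePresentation R M := by
  obtain ⟨n, π, hπ⟩ := Module.Finite.exists_fin' R M
  exact Module.finitePresentation_of_surjective π hπ <|
    fg_of_forall_exists_extension _ fun A _ _ hA f ↦
      ((hM A hA).of_linearEquiv (π.quotKerEquivOfSurjective hπ)).exists_extension f

lemma isCoherentRing_of_isFPHereditary (hR : IsFPHereditary R) : IsCoherentRing R :=
  fun I hI ↦ have : Module.Finite R I := .of_fg hI; (hR I).finitePresentation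

lemma isDWRing_of_forall_isWFPProjective (h : ∀ I : Ideal R, IsWFPProjective R I) :
    IsDWRing R :=
  isDWRing_of_forall_isGVIdeal_eq_top fun J hJ ↦
    have := isCoherentRing_of_isFPHereditary (fun I ↦ (h I).isFPProjective) J hJ.1
    hJ.eq_top fun T _ _ hT ↦ h J T (hJ.isAbsolutelyWPure hT)

end WFP

theorem mainTheorem4 (R : Type u) [CommRing R] :
    List.TFAE [
      WFP.wfpD R ≤ 1,
      ∀ (M : Type u) [AddCommGroup M] [Module R M], WFP.IsWFPProjective R M →
        ∀ N : Submodule R M, WFP.IsWFPProjective R N,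
      ∀ (P : Type u) [AddCommGroup P] [Module R P], Module.Projective R P →
        ∀ N : Submodule R P, WFP.IsWFPProjective R N,
      ∀ I : Ideal R, WFP.IsWFPProjective R I,
      ∀ (A : Type u) [AddCommGroup A] [Module R A], WFP.IsAbsolutelyWPure R A →
        injectiveDimension (ModuleCat.of R A) ≤ 1,
      WFP.IsFPHereditary R ∧ WFP.IsDWRing R,
      WFP.IsCoherentRing R ∧ WFP.IsFPHereditary R ∧ WFP.IsDWRing R] := by
  tfae_have 1 → 4 := fun h I ↦
    (WFP.isWFPProjective_iff_extVanishes_two I).mpr (WFP.wfpD_le_one_iff.mp h (R ⧸ I) inferInstance)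
  tfae_have 4 → 5 := fun h A _ _ hA ↦ WFP.injectiveDimension_le_one_of_extVanishes
    fun I ↦ (WFP.isWFPProjective_iff_extVanishes_two I).mp (h I) A hA
  tfae_have 5 → 1 := fun h ↦ WFP.wfpD_le_one_iff.mpr fun M _ _ _ A _ _ hA ↦
    WFP.extVanishes_two_of_injectiveDimension_le_one (h A hA)
  tfae_have 5 → 2 := fun h M _ _ hM N A _ _ hA ↦
    (hM A hA).submodule N (WFP.extVanishes_two_of_injectiveDimension_le_one (h A hA))
  tfae_have 2 → 3 := fun h P _ _ _ ↦ h P fun A _ _ _ ↦ WFP.extVanishes_of_projective 0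
  tfae_have 3 → 4 := fun h I ↦ h R inferInstance I
  tfae_have 4 → 7 := fun h ↦
    have hR : WFP.IsFPHereditary R := fun I ↦ (h I).isFPProjective
    ⟨WFP.isCoherentRing_of_isFPHereditary hR, hR, WFP.isDWRing_of_forall_isWFPProjective h⟩
  tfae_have 7 → 6 := fun h ↦ h.2
  tfae_have 6 → 4 := fun h I ↦
    h.2.isWFPProjective (h.1 I)
  tfae_finish
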